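/- Consider the merging problem with three items and two slots. The ad contributions $a_1,a_2,a_3$ are independent real random variables with arbitrary laws $G_1,G_2,G_3$ of finite mean, $G=G_1\times G_2\times G_3$, and $o_1,o_2,o_3$ are real numbers, the contributions of the organic forms. (In the auction model $a_i=\phi_i(b_i)\alpha_i^A+\gamma_i^A$ and $o_i=\gamma_i^O$, where $b_i$ is the bid of owner $i$, $\phi_i$ its virtual value function, $\alpha_i^A$ the click-through rate of the ad form, and $\gamma_i^A,\gamma_i^O$ the user-experience values of the two forms.) A mechanism is a pair of measurable allocation rules $x,y:\mathbb R^3\to\{0,1\}^3$, where $x_i(a)=1$ means that the ad form $\mathrm{Ad}_i$ and $y_i(a)=1$ that the organic form $\mathrm{Org}_i$ of item $i$ is displayed at profile $a$. It is admissible if, for all $a$ and all $i$, - $\sum_{i}(x_i(a)+y_i(a))\le 2$ and $x_i(a)+y_i(a)\le 1$; - $y_i(a)$ does not depend on $a_i$ (form stability); - $x_i(a)$ is nondecreasing in $a_i$ (allocation monotonicity). It is optimal if it is admissible and maximizes $\mathbb E_{a\sim G}\big[\sum_i (a_i x_i(a)+o_i y_i(a))\big]$ among all admissible mechanisms. **Lemma.**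 1. Suppose that $(x^*,y^*)$ is the optimal mechanism, in the sense that it is optimal and every optimal mechanism $(x',y')$ satisfies $y'=y^*$ $G$-almost everywhere. Let $i,j\in\{1,2,3\}$. If $y_i^*(a)=1$ and $y_j^*(a)=0$ hold on a set of profiles $a$ of positive $G$-probability, then for $G$-almost every profile $a'$ it is not the case that $y_i^*(a')=0$ and $y_j^*(a')=1$. 2. Without any uniqueness assumption, there is an optimal mechanism $(x^*,y^*)$ such that for all $i,j\in\{1,2,3\}$: if $y_i^*(a)=1$ and $y_j^*(a)=0$ for some profile $a\in\mathbb R^3$, then there is no profile $a'\in\mathbb R^3$ with $y_i^*(a')=0$ and $y_j^*(a')=1$. -/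

import Mathlib

open MeasureTheory

/-- A pair of allocation rules for `n` items. `M.x a i` says whether item `i` is displayed as an ad
at the profile `a`, and `M.y a i` whether it is displayed in its organic form. -/
structure MergingMechanism (n : ℕ) where
  x : (Fin n → ℝ) → Fin n → ℝ
  y : (Fin n → ℝ) → Fin n → ℝ

namespace MergingMechanism

variable {n : ℕ}

/-- The constraints of the merging problem with `n` items and `k` slots. -/
structure IsFeasible (k : ℕ) (M : MergingMechanism n) : Prop where
  measurable_x : ∀ i, Measurable fun a => M.x a i
  measurable_y : ∀ i, Measurable fun a => M.y a i
  /-- Allocations are deterministic. -/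
  x_binary : ∀ a i, M.x a i = 0 ∨ M.x a i = 1
  y_binary : ∀ a i, M.y a i = 0 ∨ M.y a i = 1
  /-- At most `k` slots are used. -/
  slots : ∀ a, ∑ i, (M.x a i + M.y a i) ≤ k
  /-- No item is displayed in both forms. -/
  one_form : ∀ a i, M.x a i + M.y a i ≤ 1
  /-- Form stability: `y i` does not depend on the own coordinate `a i`. -/
  form_stable : ∀ a i s t, M.y (Function.update a i s) i = M.y (Function.update a i t) i
  /-- Allocation monotonicity: `x i` is nondecreasing in the own coordinate `a i`. -/
  monotone_x : ∀ a i s t, s < t → M.x (Function.update a i s) i ≤ M.x (Function.update a i t) i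

/-- The platform's expected objective, the ad contributions `a i` being independent with laws
`G i`, and `o i` being the contribution of the organic form of item `i`. -/
noncomputable def objective (G : Fin n → Measure ℝ) (o : Fin n → ℝ) (M : MergingMechanism n) : ℝ :=
  ∫ a, ∑ i, (a i * M.x a i + o i * M.y a i) ∂(Measure.pi G)

/-- `M` solves the merging problem with `n` items and `k` slots. -/
def IsOptimal (k : ℕ) (G : Fin n → Measure ℝ) (o : Fin n → ℝ) (M : MergingMechanism n) : Prop :=
  M.IsFeasible k ∧ ∀ M' : MergingMechanism n, M'.IsFeasible k → M'.objective G o ≤ M.objective G o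

/-- `M` is *the* optimal mechanism as far as organic items are concerned: it is optimal, and every
optimal mechanism displays the same organic items as `M` at almost every profile. -/
def IsTheOptimal (k : ℕ) (G : Fin n → Measure ℝ) (o : Fin n → ℝ) (M : MergingMechanism n) : Prop :=
  M.IsOptimal k G o ∧
    ∀ M' : MergingMechanism n, M'.IsOptimal k G o → ∀ᵐ a ∂(Measure.pi G), M'.y a = M.y a

end MergingMechanism

/-! Give item `i` an index `c i` with `o i = E[max(a i⁺, c i)]`, or a negative one if `o i < E[a
i⁺]`. By form stability `y i` is independent of `a i` (`integral_coord_mul`), so replacing `o i` by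
the capped value `max(a i⁺, c i)` never lowers the objective. The relaxed problem is solved
pointwise: no profile yields more than its two largest capped values (`IsFeasible.sum_capped_le`),
and `indexMechanism` attains this. It uses organic forms only at nonnegative index, where the
replacement is exact, so it is optimal. Its organic sets are nested by index
(`indexMechanism_nested`), which gives part 2; under uniqueness every optimum has the same organic
forms almost everywhere, which gives part 1. -/

namespace MergingMechanism

/-- The value `max (t⁺) c` of an item with ad contribution `t` whose organic form has index `c`. -/
def capped (c t : ℝ) : ℝ := max (max t 0) c

lemma capped_nonneg (c t : ℝ) : 0 ≤ capped c t :=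
  le_max_of_le_left (le_max_right _ _)

lemma le_capped (c t : ℝ) : t ≤ capped c t :=
  le_max_of_le_left (le_max_left _ _)

lemma index_le_capped (c t : ℝ) : c ≤ capped c t := le_max_right _ _

lemma capped_mono (c : ℝ) {s t : ℝ} (h : s ≤ t) : capped c s ≤ capped c t :=
  max_le_max (max_le_max h le_rfl) le_rfl

@[fun_prop]
lemma measurable_capped (c : ℝ) : Measurable (capped c) := by
  unfold capped; fun_prop

lemma integrable_capped {μ : Measure ℝ} [IsProbabilityMeasure μ]
    (hμ : Integrable (fun t : ℝ => t) μ) (c : ℝ) : Integrable (capped c) μ :=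
  (hμ.sup (integrable_const 0)).sup (integrable_const c)

lemma continuous_integral_capped {μ : Measure ℝ} [IsProbabilityMeasure μ]
    (hμ : Integrable (fun t : ℝ => t) μ) : Continuous fun c => ∫ t, capped c t ∂μ := by
  refine LipschitzWith.continuous (K := 1) (LipschitzWith.of_dist_le_mul fun c d => ?_)
  rw [dist_eq_norm, ← integral_sub (integrable_capped hμ c) (integrable_capped hμ d)]
  refine (norm_integral_le_of_norm_le_const (C := |c - d|) (ae_of_all _ fun t => ?_)).trans ?_
  · exact abs_max_sub_max_le_max _ _ _ _ |>.trans (by simp)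
  · simp [Real.dist_eq]

/-- The index of an item: the cap at which the capped ad is worth as much as the organic form,
or a negative number if the organic form is worth less than the ad. -/
lemma exists_index {μ : Measure ℝ} [IsProbabilityMeasure μ]
    (hμ : Integrable (fun t : ℝ => t) μ) (o : ℝ) :
    ∃ c, o ≤ ∫ t, capped c t ∂μ ∧ (0 ≤ c → o = ∫ t, capped c t ∂μ) := by
  rcases lt_or_ge o (∫ t, capped 0 t ∂μ) with h | h
  -- Any negative cap is inactive against `t⁺`, so `-1` gives the same integral as `0`.
  · refine ⟨-1, h.le.trans (le_of_eq ?_), fun h => by norm_num at h⟩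
    refine integral_congr_ae (ae_of_all _ fun t => ?_)
    have : (0 : ℝ) ≤ max t 0 := le_max_right _ _
    exact (max_eq_left this).trans (max_eq_left (by linarith)).symm
  · have h0 : 0 ≤ o := (integral_nonneg fun t => capped_nonneg 0 t).trans h
    have h1 : o ≤ ∫ t, capped o t ∂μ := by
      have := integral_mono (integrable_const o) (integrable_capped hμ o)
        (fun t => index_le_capped o t)
      simpa using this
    obtain ⟨c, -, hc⟩ := intermediate_value_Icc h0
      (continuous_integral_capped hμ).continuousOn ⟨h, h1⟩
    exact ⟨c, hc.ge, fun _ => hc.symm⟩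

/-- A function of the `i`-th coordinate is independent of a function of the other coordinates. -/
lemma integral_coord_mul {n : ℕ} (G : Fin (n + 1) → Measure ℝ) [∀ i, IsProbabilityMeasure (G i)]
    (i : Fin (n + 1)) (f : ℝ → ℝ) (g : (Fin (n + 1) → ℝ) → ℝ)
    (hg : ∀ a s t, g (Function.update a i s) = g (Function.update a i t)) :
    ∫ a, f (a i) * g a ∂(Measure.pi G) = (∫ t, f t ∂(G i)) * ∫ a, g a ∂(Measure.pi G) := by
  -- Stated for all `F`, so that `F = 1` identifies the integral over the other coordinates with
  -- that of `g`.
  have key : ∀ F : ℝ → ℝ, ∫ a, F (a i) * g a ∂(Measure.pi G) =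
      (∫ t, F t ∂(G i)) *
        ∫ z, g (i.insertNth 0 z) ∂(Measure.pi fun j => G (i.succAbove j)) := by
    intro F
    have e := (measurePreserving_piFinSuccAbove G i).symm
    rw [← integral_prod_mul F fun z => g (i.insertNth 0 z), ← e.integral_comp']
    refine integral_congr_ae (ae_of_all _ fun z => ?_)
    have h := hg (i.insertNth 0 z.2) z.1 0
    simp only [Fin.update_insertNth] at h
    simp [MeasurableEquiv.piFinSuccAbove, Fin.insertNthEquiv, h]
  have h1 := key fun _ => 1
  simp only [one_mul, integral_const, probReal_univ, one_smul] at h1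
  rw [key f, h1]

/-- Item `j`, of capped value `capped (c j) (a j)`, is preferred to item `i` at value `w`; ties are
broken by the ranking `r`. -/
def Beats (c : Fin 3 → ℝ) (r : Fin 3 → Fin 3) (a : Fin 3 → ℝ) (j i : Fin 3) (w : ℝ) : Prop :=
  w < capped (c j) (a j) ∨ (w = capped (c j) (a j) ∧ r j < r i)

/-- Item `i` at value `w` is among the best two of three. -/
def TopTwo (c : Fin 3 → ℝ) (r : Fin 3 → Fin 3) (a : Fin 3 → ℝ) (i : Fin 3) (w : ℝ) : Prop :=
  ∃ j, j ≠ i ∧ ¬ Beats c r a j i w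

/-! ### Ranking by capped values -/

section Index

variable {c : Fin 3 → ℝ} {r : Fin 3 → Fin 3}

lemma Beats.anti {a : Fin 3 → ℝ} {j i : Fin 3} {w w' : ℝ} (h : Beats c r a j i w)
    (hw : w' ≤ w) : Beats c r a j i w' := by
  rcases h with h | ⟨h, hr⟩
  · exact Or.inl (hw.trans_lt h)
  · rcases hw.lt_or_eq with hw | rfl
    · exact Or.inl (hw.trans_eq h)
    · exact Or.inr ⟨h, hr⟩

lemma TopTwo.mono {a : Fin 3 → ℝ} {i : Fin 3} {w w' : ℝ} (h : TopTwo c r a i w)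
    (hw : w ≤ w') : TopTwo c r a i w' := by
  obtain ⟨j, hj, h⟩ := h
  exact ⟨j, hj, fun h' => h (h'.anti hw)⟩

lemma topTwo_update (a : Fin 3 → ℝ) (i : Fin 3) (s w : ℝ) :
    TopTwo c r (Function.update a i s) i w ↔ TopTwo c r a i w := by
  refine exists_congr fun j => and_congr_right fun hj => ?_
  simp [Beats, Function.update_of_ne hj]

lemma exists_last (hr : Function.Injective r) (a : Fin 3 → ℝ) :
    ∃ k, ∀ j, j ≠ k → Beats c r a j k (capped (c k) (a k)) := by
  -- A smaller rank is better, so the rank is dualized to make the lexicographic minimum the worst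
  -- item.
  obtain ⟨k, hk⟩ := Finite.exists_min
    fun i => toLex (capped (c i) (a i), OrderDual.toDual (r i))
  refine ⟨k, fun j hj => ?_⟩
  rcases Prod.Lex.toLex_le_toLex.1 (hk j) with h | ⟨h, h'⟩
  · exact Or.inl h
  · exact Or.inr ⟨h, lt_of_le_of_ne (OrderDual.toDual_le_toDual.1 h') (hr.ne hj)⟩

lemma Beats.asymm {a : Fin 3 → ℝ} {j k : Fin 3} (h : Beats c r a j k (capped (c k) (a k))) :
    ¬ Beats c r a k j (capped (c j) (a j)) := by
  rintro (h' | ⟨h', hr'⟩) <;> rcases h with h | ⟨h, hr⟩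
  · exact h.not_gt h'
  · exact h'.ne h.symm
  · exact h.ne' h'
  · exact hr.not_gt hr'

lemma measurable_topTwo (i : Fin 3) {f : (Fin 3 → ℝ) → ℝ} (hf : Measurable f) :
    MeasurableSet {a | TopTwo c r a i (f a)} := by
  have hc : ∀ j, Measurable fun a : Fin 3 → ℝ => capped (c j) (a j) := fun j => by fun_prop
  simp only [TopTwo, Set.ofPred_exists, Set.ofPred_and]
  refine MeasurableSet.iUnion fun j => (MeasurableSet.const _).inter (MeasurableSet.compl ?_)
  exact (measurableSet_lt hf (hc j)).union
    ((measurableSet_eq_fun hf (hc j)).inter (MeasurableSet.const _))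

end Index

open Classical in
/-- The index mechanism: an organic form is displayed if its index is nonnegative and among the best
two, an ad if its value is positive and among the best two. -/
noncomputable def indexMechanism (c : Fin 3 → ℝ) (r : Fin 3 → Fin 3) : MergingMechanism 3 where
  y a i := if 0 ≤ c i ∧ TopTwo c r a i (c i) then 1 else 0
  x a i := if ¬ (0 ≤ c i ∧ TopTwo c r a i (c i)) ∧ 0 < a i ∧
    TopTwo c r a i (capped (c i) (a i)) then 1 else 0

/-! ### Feasibility, nestedness and pointwise optimality -/

section Index

variable {c : Fin 3 → ℝ} {r : Fin 3 → Fin 3}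

lemma indexMechanism_one_form (a : Fin 3 → ℝ) (i : Fin 3) :
    (indexMechanism c r).x a i + (indexMechanism c r).y a i ≤ 1 := by
  simp only [indexMechanism]
  split_ifs with h h' <;> first | exact absurd h' h.1 | norm_num

lemma indexMechanism_last {a : Fin 3 → ℝ} {k : Fin 3}
    (hk : ∀ j, j ≠ k → Beats c r a j k (capped (c k) (a k))) :
    (indexMechanism c r).x a k = 0 ∧ (indexMechanism c r).y a k = 0 := by
  have h : ¬ TopTwo c r a k (capped (c k) (a k)) := fun ⟨j, hj, h⟩ => h (hk j hj)
  have h' : ¬ TopTwo c r a k (c k) := fun h' => h (h'.mono (index_le_capped _ _))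
  simp [indexMechanism, h, h']

/-- If item `j` is in the top two but not shown organically, its cap cannot bind with `c j ≥ 0`, so
its capped value is `(a j)⁺`: the ad, or an empty slot, earns exactly that. -/
lemma indexMechanism_not_last {a : Fin 3 → ℝ} {j k : Fin 3}
    (hk : ∀ j, j ≠ k → Beats c r a j k (capped (c k) (a k))) (hj : j ≠ k) :
    a j * (indexMechanism c r).x a j + capped (c j) (a j) * (indexMechanism c r).y a j =
      capped (c j) (a j) := by
  have h : TopTwo c r a j (capped (c j) (a j)) := ⟨k, hj.symm, (hk j hj).asymm⟩
  by_cases hy : 0 ≤ c j ∧ TopTwo c r a j (c j)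
  · simp [indexMechanism, hy]
  · have hcap : capped (c j) (a j) = max (a j) 0 := by
      refine max_eq_left (le_of_not_gt fun hlt => hy ?_)
      have e : capped (c j) (a j) = c j := max_eq_right hlt.le
      exact ⟨(le_max_right _ _).trans hlt.le, e ▸ h⟩
    by_cases ha : 0 < a j
    · have e := hcap.trans (max_eq_left ha.le)
      rw [e] at h
      simp [indexMechanism, hy, h, ha, e]
    · simp [indexMechanism, hy, ha, hcap.trans (max_eq_right (not_lt.1 ha))]

lemma indexMechanism_isFeasible (hr : Function.Injective r) :
    (indexMechanism c r).IsFeasible 2 where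
  measurable_x i := by
    refine Measurable.ite ?_ measurable_const measurable_const
    refine MeasurableSet.inter (MeasurableSet.compl ((MeasurableSet.const _).inter
      (measurable_topTwo i measurable_const))) (MeasurableSet.inter ?_ (measurable_topTwo i ?_))
    · exact measurableSet_lt measurable_const (measurable_pi_apply i)
    · fun_prop
  measurable_y i := Measurable.ite ((MeasurableSet.const _).inter
    (measurable_topTwo i measurable_const)) measurable_const measurable_const
  x_binary a i := by simp only [indexMechanism]; split_ifs <;> simp
  y_binary a i := by simp only [indexMechanism]; split_ifs <;> simp
  slots a := by
    obtain ⟨k, hk⟩ := exists_last (c := c) hr a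
    obtain ⟨hx, hy⟩ := indexMechanism_last hk
    have h := indexMechanism_one_form (c := c) (r := r) a
    rw [← Finset.add_sum_erase _ _ (Finset.mem_univ k), hx, hy]
    refine (add_le_add le_rfl (Finset.sum_le_card_nsmul _ _ 1 fun i _ => h i)).trans ?_
    simp
  one_form := indexMechanism_one_form
  form_stable a i s t := by classical exact if_congr (and_congr_right fun _ =>
    (topTwo_update a i s _).trans (topTwo_update a i t _).symm) rfl rfl
  monotone_x a i s t hst := by
    simp only [indexMechanism]
    split_ifs with h h' <;> try norm_num
    refine h' ?_
    rw [topTwo_update, topTwo_update, Function.update_self] at h ⊢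
    exact ⟨h.1, h.2.1.trans hst, h.2.2.mono (capped_mono _ hst.le)⟩

/-- The organic items of the index mechanism are nested: items with smaller indices are displayed
only together with those of larger indices. -/
lemma indexMechanism_nested (hc : ∀ i j, r i < r j → c j ≤ c i) {i j : Fin 3} (hij : r i < r j)
    {a : Fin 3 → ℝ} (h : (indexMechanism c r).y a j = 1) : (indexMechanism c r).y a i = 1 := by
  simp only [indexMechanism, ite_eq_left_iff, zero_ne_one, imp_false, not_not] at h ⊢
  obtain ⟨h0, k, hkj, hk⟩ := h
  have hcij := hc i j hij
  -- Item `i` beats `j` at value `c j`, since its capped value is at least `c i ≥ c j` and its rank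
  -- is better.
  have hki : k ≠ i := by
    rintro rfl
    refine hk ?_
    rcases (hcij.trans (index_le_capped (c k) (a k))).lt_or_eq with h | h
    · exact Or.inl h
    · exact Or.inr ⟨h, hij⟩
  refine ⟨h0.trans hcij, k, hki, fun hb => hk ?_⟩
  rcases hb.anti hcij with h | ⟨h, h'⟩
  · exact Or.inl h
  · exact Or.inr ⟨h, h'.trans hij⟩

/-- The index mechanism displays the two items of largest capped values. -/
lemma IsFeasible.sum_capped_le (hr : Function.Injective r) {M : MergingMechanism 3}
    (hM : M.IsFeasible 2) (a : Fin 3 → ℝ) :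
    ∑ i, (a i * M.x a i + capped (c i) (a i) * M.y a i) ≤
      ∑ i, (a i * (indexMechanism c r).x a i +
        capped (c i) (a i) * (indexMechanism c r).y a i) := by
  obtain ⟨k, hk⟩ := exists_last (c := c) hr a
  obtain ⟨hx, hy⟩ := indexMechanism_last hk
  set W := fun i => capped (c i) (a i)
  have hWk : ∀ j, W k ≤ W j := fun j => by
    by_cases hj : j = k
    · rw [hj]
    · rcases hk j hj with h | ⟨h, -⟩
      exacts [h.le, h.le]
  have hx0 : ∀ i, 0 ≤ M.x a i := fun i => by rcases hM.x_binary a i with h | h <;> simp [h]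
  have hrhs : ∑ i, (a i * (indexMechanism c r).x a i + W i * (indexMechanism c r).y a i) =
      ∑ i, W i - W k := by
    rw [← Finset.add_sum_erase _ _ (Finset.mem_univ k),
      ← Finset.add_sum_erase _ W (Finset.mem_univ k), hx, hy,
      Finset.sum_congr rfl fun j hj => indexMechanism_not_last hk (Finset.ne_of_mem_erase hj)]
    ring
  have hslots := hM.slots a
  -- The least capped value `W k` prices a slot: leaving item `i` out forgoes `W i ≥ W k`, and at
  -- least one of the three items is left out.
  have h1 : ∑ i, (a i * M.x a i + W i * M.y a i) ≤ ∑ i, (W i - W k * (1 - (M.x a i + M.y a i))) := by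
    refine Finset.sum_le_sum fun i _ => ?_
    have h2 := mul_le_mul_of_nonneg_right (le_capped (c i) (a i)) (hx0 i)
    have h3 := mul_le_mul_of_nonneg_right (hWk i) (sub_nonneg.2 (hM.one_form a i))
    simp only [W] at h2 h3 ⊢
    linarith
  refine h1.trans (le_of_le_of_eq ?_ hrhs.symm)
  have h4 : W k * (∑ i, (M.x a i + M.y a i)) ≤ W k * 2 :=
    mul_le_mul_of_nonneg_left (by exact_mod_cast hslots) (capped_nonneg _ _)
  rw [Finset.sum_sub_distrib, ← Finset.mul_sum, Finset.sum_sub_distrib]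
  simp only [Finset.sum_const, Finset.card_univ, Fintype.card_fin]
  norm_num
  linarith

end Index

/-! ### Passing to expectations -/

section Objective

variable {G : Fin 3 → Measure ℝ} [∀ i, IsProbabilityMeasure (G i)] {M : MergingMechanism 3} {k : ℕ}

lemma integrable_eval_mul_of_binary {i : Fin 3} {f : ℝ → ℝ} (hf : Integrable f (G i))
    {g : (Fin 3 → ℝ) → ℝ} (hg : Measurable g) (hb : ∀ a, g a = 0 ∨ g a = 1) :
    Integrable (fun a => f (a i) * g a) (Measure.pi G) := by
  refine (integrable_comp_eval hf).mul_bdd (c := 1) hg.aestronglyMeasurable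
    (ae_of_all _ fun a => ?_)
  rcases hb a with h | h <;> simp [h]

lemma IsFeasible.objective_eq (hM : M.IsFeasible k)
    (hG : ∀ i, Integrable (fun t : ℝ => t) (G i)) (o : Fin 3 → ℝ) :
    M.objective G o = ∑ i, (∫ a, a i * M.x a i ∂(Measure.pi G) +
      o i * ∫ a, M.y a i ∂(Measure.pi G)) := by
  have hx i := integrable_eval_mul_of_binary (hG i) (hM.measurable_x i) fun a => hM.x_binary a i
  have hy i := integrable_eval_mul_of_binary (integrable_const (μ := G i) (o i))
    (hM.measurable_y i) fun a => hM.y_binary a i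
  refine (integral_finsetSum _ fun i _ => (hx i).add (hy i)).trans ?_
  refine Finset.sum_congr rfl fun i _ => ?_
  exact (integral_add (hx i) (hy i)).trans (by rw [integral_const_mul])

lemma IsFeasible.integral_capped_eq (hM : M.IsFeasible k)
    (hG : ∀ i, Integrable (fun t : ℝ => t) (G i)) (c : Fin 3 → ℝ) :
    Integrable (fun a => ∑ i, (a i * M.x a i + capped (c i) (a i) * M.y a i)) (Measure.pi G) ∧
    ∫ a, ∑ i, (a i * M.x a i + capped (c i) (a i) * M.y a i) ∂(Measure.pi G) =
      ∑ i, (∫ a, a i * M.x a i ∂(Measure.pi G) +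
        (∫ t, capped (c i) t ∂(G i)) * ∫ a, M.y a i ∂(Measure.pi G)) := by
  have hx i := integrable_eval_mul_of_binary (hG i) (hM.measurable_x i) fun a => hM.x_binary a i
  have hy i := integrable_eval_mul_of_binary (integrable_capped (hG i) (c i))
    (hM.measurable_y i) fun a => hM.y_binary a i
  refine ⟨integrable_finsetSum _ fun i _ => (hx i).add (hy i), ?_⟩
  refine (integral_finsetSum _ fun i _ => (hx i).add (hy i)).trans ?_
  refine Finset.sum_congr rfl fun i _ => ?_
  refine (integral_add (hx i) (hy i)).trans ?_
  rw [integral_coord_mul G i (capped (c i)) (fun a => M.y a i) fun a s t => hM.form_stable a i s t]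

lemma indexMechanism_isOptimal (hG : ∀ i, Integrable (fun t : ℝ => t) (G i)) {o c : Fin 3 → ℝ}
    {r : Fin 3 → Fin 3} (hr : Function.Injective r)
    (hle : ∀ i, o i ≤ ∫ t, capped (c i) t ∂(G i))
    (heq : ∀ i, 0 ≤ c i → o i = ∫ t, capped (c i) t ∂(G i)) :
    (indexMechanism c r).IsOptimal 2 G o := by
  have hI := indexMechanism_isFeasible (c := c) hr
  refine ⟨hI, fun M hM => ?_⟩
  obtain ⟨hint, hval⟩ := hM.integral_capped_eq hG c
  obtain ⟨hintI, hvalI⟩ := hI.integral_capped_eq hG c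
  rw [hM.objective_eq hG, hI.objective_eq hG]
  calc _ ≤ _ := Finset.sum_le_sum fun i _ => add_le_add le_rfl
        (mul_le_mul_of_nonneg_right (hle i) (integral_nonneg fun a => by
          rcases hM.y_binary a i with h | h <;> simp [h]))
    _ = _ := hval.symm
    _ ≤ _ := integral_mono hint hintI fun a => hM.sum_capped_le hr a
    _ = _ := hvalI
    _ = _ := Finset.sum_congr rfl fun i _ => ?_
  -- For a negative index the organic form is never shown, so the inexact replacement costs nothing.
  by_cases hi : 0 ≤ c i
  · rw [heq i hi]
  · simp [indexMechanism, hi]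

end Objective

end MergingMechanism

open MergingMechanism in
theorem mainTheorem9 (G : Fin 3 → Measure ℝ) [∀ i, IsProbabilityMeasure (G i)]
    (hG : ∀ i, Integrable (fun t : ℝ => t) (G i)) (o : Fin 3 → ℝ) :
    (∀ M : MergingMechanism 3, M.IsTheOptimal 2 G o → ∀ i j : Fin 3,
      (∃ᵐ a ∂(Measure.pi G), M.y a i = 1 ∧ M.y a j = 0) →
        ∀ᵐ a' ∂(Measure.pi G), ¬ (M.y a' i = 0 ∧ M.y a' j = 1)) ∧
    (∃ M : MergingMechanism 3, M.IsOptimal 2 G o ∧ ∀ i j : Fin 3,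
      (∃ a, M.y a i = 1 ∧ M.y a j = 0) → ∀ a', ¬ (M.y a' i = 0 ∧ M.y a' j = 1)) := by
  choose c hle heq using fun i => exists_index (hG i) (o i)
  -- Items are ranked by decreasing index, the sort breaking ties.
  have hr : Function.Injective (Tuple.sort (-c)).symm := Equiv.injective _
  have hc : ∀ i j, (Tuple.sort (-c)).symm i < (Tuple.sort (-c)).symm j → c j ≤ c i := by
    intro i j hij
    have := Tuple.monotone_sort (-c) hij.le
    simpa using this
  have hopt := indexMechanism_isOptimal hG hr hle heq
  have hnest : ∀ i j : Fin 3, (∃ a, (indexMechanism c (Tuple.sort (-c)).symm).y a i = 1 ∧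
      (indexMechanism c (Tuple.sort (-c)).symm).y a j = 0) →
      ∀ a', ¬ ((indexMechanism c (Tuple.sort (-c)).symm).y a' i = 0 ∧
        (indexMechanism c (Tuple.sort (-c)).symm).y a' j = 1) := by
    rintro i j ⟨a, hi, hj⟩ a' ⟨hi', hj'⟩
    rcases lt_trichotomy ((Tuple.sort (-c)).symm i) ((Tuple.sort (-c)).symm j) with h | h | h
    · exact zero_ne_one (hi'.symm.trans (indexMechanism_nested hc h hj'))
    · exact zero_ne_one (hj.symm.trans (hr h ▸ hi))
    · exact zero_ne_one (hj.symm.trans (indexMechanism_nested hc h hi))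
  refine ⟨fun M hM i j hij => ?_, _, hopt, hnest⟩
  have hae := hM.2 _ hopt
  obtain ⟨a, ha, hy⟩ := (hij.and_eventually hae).exists
  filter_upwards [hae] with a' ha'
  rw [← ha']
  rw [← hy] at ha
  exact hnest i j ⟨a, ha⟩ a'
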